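/- Let $d\ge 1$ and $\sigma>0$. Let $\psi:\mathbb R^d\to\mathbb R$ be bounded, continuous, Lebesgue integrable, and positive definite, i.e. symmetric ($\psi(-x)=\psi(x)$) with $\sum_{i,j}\alpha_i\alpha_j\psi(x_i-x_j)\ge 0$ for all finite families $x_i\in\mathbb R^d$, $\alpha_i\in\mathbb R$. Let $k(x,y)=\psi(x-y)$, let $\mathcal H_k$ be its reproducing kernel Hilbert space, and for a Borel probability measure $P$ on $\mathbb R^d$ let $\mu_k(P)=\int k(\cdot,x)\,dP(x)\in\mathcal H_k$ (Bochner integral) be its kernel mean embedding. Assume that $k$ is characteristic, i.e. that $P\mapsto\mu_k(P)$ is injective on Borel probability measures. Put $\psi^\wedge(w)=(2\pi)^{-d/2}\int_{\mathbb R^d}\psi(x)e^{-i\langle w,x\rangle}\,dx$, which is real valued since $\psi$ is real and symmetric. Then there are constants $\epsilon,c>0$, depending only on $\psi$ and $\sigma^2$, such that for every $a\in\mathbb R^d$ with $\|a\|_2^2\le\epsilon$ $$c\le\min_{e\in S^{d-1}}2\int_{\mathbb R^d}e^{-\sigma^2\|w\|_2^2}\langle e,w\rangle^2\cos(\langle a,w\rangle)\,(\psi^\wedge(w))^2\,dw<\infty,$$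 where $S^{d-1}$ is the Euclidean unit sphere, the integrals converge absolutely and the minimum is attained. Moreover, for all $\mu_0,\mu_1\in\mathbb R^d$ with $\|\mu_0-\mu_1\|_2^2\le\epsilon$, the kernel mean embeddings $\theta_0,\theta_1$ of the Gaussian measures $N(\mu_0,\sigma^2I)$ and $N(\mu_1,\sigma^2I)$ belong to $L^2(\mathbb R^d)$ and $$\|\theta_0-\theta_1\|_{L^2(\mathbb R^d)}\ge\sqrt{\frac c2}\,\|\mu_0-\mu_1\|_2 .$$ -/

import Mathlib

open MeasureTheory ProbabilityTheory
open scoped BoundedContinuousFunction RealInnerProductSpace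

/-- A real function `ψ` on an additive group is positive definite: it is symmetric and all its
quadratic forms `∑ i, ∑ j, α i * α j * ψ (x i - x j)` are nonnegative. -/
def IsPosDefFun {V : Type*} [AddGroup V] (ψ : V → ℝ) : Prop :=
  (∀ x, ψ (-x) = ψ x) ∧
    ∀ (n : ℕ) (x : Fin n → V) (α : Fin n → ℝ),
      0 ≤ ∑ i, ∑ j, α i * α j * ψ (x i - x j)

/-- The translation invariant kernel `k (x, y) = ψ (x - y)`. Mathlib's reproducing kernels are
operator valued, so the scalar `ψ (x - y)` is read as multiplication by it on `ℝ`. -/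
noncomputable def transKernel {V : Type*} [AddGroup V] (ψ : V → ℝ) : Matrix V V (ℝ →L[ℝ] ℝ) :=
  Matrix.of fun x y => ψ (x - y) • ContinuousLinearMap.id ℝ ℝ

theorem transKernel_posSemidef {V : Type*} [AddGroup V] {ψ : V → ℝ} (h : IsPosDefFun ψ) :
    (transKernel ψ).PosSemidef := by
  have key := (RKHS.posSemidef_tfae (𝕜 := ℝ) (K := transKernel ψ)).out 0 2
  refine key.mpr ⟨?_, fun f => ?_⟩
  · ext x y
    have h1 : ψ (y - x) = ψ (x - y) := by rw [← h.1 (x - y), neg_sub]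
    simp [transKernel, Matrix.conjTranspose_apply, h1, ContinuousLinearMap.star_eq_adjoint,
      ContinuousLinearMap.adjoint_id]
  · have e := f.support.equivFin
    have h2 := h.2 f.support.card (fun i => (e.symm i : V)) (fun i => f (e.symm i : V))
    have h3 : (∑ i, ∑ j, f (e.symm i : V) * f (e.symm j : V) *
        ψ ((e.symm i : V) - (e.symm j : V))) =
        ∑ x ∈ f.support, ∑ y ∈ f.support, f x * f y * ψ (x - y) := by
      rw [← Finset.sum_coe_sort f.support, ← e.symm.sum_comp]
      refine Finset.sum_congr rfl fun i _ => ?_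
      rw [← Finset.sum_coe_sort f.support, ← e.symm.sum_comp]
    rw [h3] at h2
    refine h2.trans (le_of_eq ?_)
    simp only [Finsupp.sum, transKernel, RCLike.re_to_real]
    rw [Finset.sum_comm]
    refine Finset.sum_congr rfl fun x _ => Finset.sum_congr rfl fun y _ => ?_
    simp
    ring

instance transKernel_fact {V : Type*} [AddGroup V] (ψ : V → ℝ) [h : Fact (IsPosDefFun ψ)] :
    Fact (transKernel ψ).PosSemidef :=
  ⟨transKernel_posSemidef h.out⟩

/-- The reproducing kernel Hilbert space of the kernel `k (x, y) = ψ (x - y)`. -/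
abbrev KernelSpace {V : Type*} [AddGroup V] (ψ : V → ℝ) [Fact (IsPosDefFun ψ)] :=
  RKHS.OfKernel (transKernel ψ)

/-- The kernel mean embedding of `P`, the Bochner integral `∫ k(·, x) dP(x)` in the reproducing
kernel Hilbert space of `k (x, y) = ψ (x - y)`. -/
noncomputable def kernelMean {V : Type*} [AddGroup V] [MeasurableSpace V] (ψ : V → ℝ)
    [Fact (IsPosDefFun ψ)] (P : Measure V) : KernelSpace ψ :=
  ∫ x, RKHS.kerFun (KernelSpace ψ) x 1 ∂P

/-- The kernel `k (x, y) = ψ (x - y)` is characteristic: the kernel mean embedding is injective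
on probability measures. -/
def IsCharacteristicFun {V : Type*} [AddGroup V] [MeasurableSpace V] (ψ : V → ℝ)
    [Fact (IsPosDefFun ψ)] : Prop :=
  Function.Injective fun P : ProbabilityMeasure V => kernelMean ψ (P : Measure V)

/-- The Fourier transform `(2π)^(-d/2) ∫ f(x) exp(-i⟨y, x⟩) dx`. -/
noncomputable def fourierHat {d : ℕ} (f : EuclideanSpace ℝ (Fin d) → ℝ)
    (y : EuclideanSpace ℝ (Fin d)) : ℂ :=
  (((2 * Real.pi) ^ (-(d : ℝ) / 2) : ℝ) : ℂ) *
    ∫ x, (f x : ℂ) * Complex.exp (-Complex.I * (⟪y, x⟫ : ℝ))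

/-- The integrand `exp(-σ²‖w‖²) ⟨e, w⟩² cos⟨a, w⟩ (ψ^(w))²`. For a symmetric real function `ψ` the
transform `ψ^` is real valued, so that it equals its real part. -/
noncomputable def weightedIntegrand {d : ℕ} (ψ : EuclideanSpace ℝ (Fin d) → ℝ) (σ : ℝ)
    (a e w : EuclideanSpace ℝ (Fin d)) : ℝ :=
  Real.exp (-σ ^ 2 * ‖w‖ ^ 2) * ⟪e, w⟫ ^ 2 * Real.cos ⟪a, w⟫ * (fourierHat ψ w).re ^ 2

open scoped FourierTransform ComplexConjugate

/-! ### Fourier transform: Gaussian moments, Plancherel, inversion. -/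

section Fourier

variable {d : ℕ}

/-! Embedding a measure convolves it with `ψ`, so on the Fourier side it multiplies `ψ^` by a
characteristic function (`fourierHat_kernelMean`). Two Gaussians with the same covariance differ
only by a phase; with `a = μ₀ - μ₁`, Plancherel turns the squared `L²` distance into `∫ exp(-σ²‖w‖²)
(ψ^)² 2(1 - cos⟨a,w⟩)` (`integral_sq_kernelMean_gaussian_sub`).

Both claims then perturb around `a = 0`. Let `m₀` be the minimum over unit `e` of `2 ∫ exp(-σ²‖w‖²)
⟨e,w⟩² (ψ^)²`. It is attained by compactness, and positive because a characteristic `ψ` is nonzero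
and the open set `ψ^ ≠ 0` lies in no hyperplane (`integral_weightedIntegrand_zero_pos`). Taylor
bounds for the cosine cost only multiples of the fourth moment `K = ∫ exp(-σ²‖w‖²) ‖w‖⁴ (ψ^)²`,
which small `‖a‖` absorbs. -/

theorem integrable_exp_neg_mul_sq_norm_mul_pow {b : ℝ} (hb : 0 < b) (k : ℕ) :
    Integrable fun w : EuclideanSpace ℝ (Fin d) => Real.exp (-b * ‖w‖ ^ 2) * ‖w‖ ^ (2 * k) := by
  have h : Integrable fun w : EuclideanSpace ℝ (Fin d) => Real.exp (-(b / 2) * ‖w‖ ^ 2) := by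
    have h1 := (GaussianFourier.integrable_cexp_neg_mul_sq_norm_add
      (V := EuclideanSpace ℝ (Fin d)) (b := ((b / 2 : ℝ) : ℂ)) (by simpa using hb) 0 0).norm
    refine h1.congr (.of_forall fun w => ?_)
    simp only [zero_mul, add_zero, Complex.norm_exp]
    congr 1
    norm_cast
  refine (h.const_mul ((k.factorial : ℝ) / (b / 2) ^ k)).mono' (by fun_prop)
    (.of_forall fun w => ?_)
  rw [Real.norm_of_nonneg (by positivity)]
  -- Half of the Gaussian exponent is spent on absorbing the polynomial.
  have h2 := Real.pow_div_factorial_le_exp (b / 2 * ‖w‖ ^ 2) (by positivity) k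
  have h3 : ‖w‖ ^ (2 * k) ≤ (k.factorial : ℝ) / (b / 2) ^ k * Real.exp (b / 2 * ‖w‖ ^ 2) := by
    rw [div_le_iff₀ (by positivity), mul_pow, ← pow_mul] at h2
    rw [div_mul_eq_mul_div, le_div_iff₀ (by positivity)]
    linarith
  calc Real.exp (-b * ‖w‖ ^ 2) * ‖w‖ ^ (2 * k)
      ≤ Real.exp (-b * ‖w‖ ^ 2) *
        ((k.factorial : ℝ) / (b / 2) ^ k * Real.exp (b / 2 * ‖w‖ ^ 2)) := by gcongr
    _ = (k.factorial : ℝ) / (b / 2) ^ k *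
        (Real.exp (-b * ‖w‖ ^ 2) * Real.exp (b / 2 * ‖w‖ ^ 2)) := by ring
    _ = _ := by rw [← Real.exp_add]; ring_nf

/-- Plancherel for functions to which pointwise inversion applies: move one transform across the
sesquilinear pairing, then invert. -/
theorem integral_norm_sq_fourier_eq {V : Type*} [NormedAddCommGroup V] [InnerProductSpace ℝ V]
    [FiniteDimensional ℝ V] [MeasurableSpace V] [BorelSpace V] {f : V → ℂ} (hc : Continuous f)
    (hf : Integrable f) (hf' : Integrable (𝓕 f)) :
    ∫ w, ‖𝓕 f w‖ ^ 2 = ∫ x, ‖f x‖ ^ 2 := by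
  have h := VectorFourier.integral_sesq_fourierIntegral_eq_neg_flip
    (innerSL ℂ (E := ℂ)) Real.continuous_fourierChar (L := innerₗ V) (μ := volume) (ν := volume)
    continuous_inner hf hf'
  have h1 : (VectorFourier.fourierIntegral Real.fourierChar volume (-(innerₗ V).flip) (𝓕 f)) =
      𝓕⁻ (𝓕 f) := by
    ext v
    simp [VectorFourier.fourierIntegral, Real.fourierInv_eq, real_inner_comm]
  rw [h1, hc.fourierInv_fourier_eq hf hf'] at h
  have h2 : ∀ z : ℂ, innerSL ℂ z z = ((‖z‖ ^ 2 : ℝ) : ℂ) := fun z => by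
    simp [inner_self_eq_norm_sq_to_K]
  change ∫ ξ, innerSL ℂ (𝓕 f ξ) (𝓕 f ξ) = _ at h
  simp_rw [h2] at h
  rw [integral_complex_ofReal, integral_complex_ofReal] at h
  exact_mod_cast h

theorem fourierHat_eq_fourier (f : EuclideanSpace ℝ (Fin d) → ℝ) (w : EuclideanSpace ℝ (Fin d)) :
    fourierHat f w = (((2 * Real.pi) ^ (-(d : ℝ) / 2) : ℝ) : ℂ) *
      𝓕 (fun x => (f x : ℂ)) ((2 * Real.pi)⁻¹ • w) := by
  rw [fourierHat, Real.fourier_eq']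
  congr 1
  refine integral_congr_ae (.of_forall fun x => ?_)
  have h : -2 * Real.pi * ⟪x, (2 * Real.pi)⁻¹ • w⟫ = -⟪w, x⟫ := by
    rw [inner_smul_right, real_inner_comm]
    field_simp
  simp only [h, smul_eq_mul]
  rw [mul_comm]
  congr 2
  push_cast
  ring

theorem continuous_fourierHat {f : EuclideanSpace ℝ (Fin d) → ℝ} (hf : Integrable f) :
    Continuous (fourierHat f) := by
  have h : Continuous (𝓕 (fun x => (f x : ℂ))) :=
    VectorFourier.fourierIntegral_continuous Real.continuous_fourierChar
      (innerSL ℝ).continuous₂ hf.ofReal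
  have h1 : fourierHat f = fun w => (((2 * Real.pi) ^ (-(d : ℝ) / 2) : ℝ) : ℂ) *
      𝓕 (fun x => (f x : ℂ)) ((2 * Real.pi)⁻¹ • w) := funext (fourierHat_eq_fourier f)
  rw [h1]
  exact continuous_const.mul (h.comp (continuous_const_smul _))

theorem norm_fourierHat_le (f : EuclideanSpace ℝ (Fin d) → ℝ) (w : EuclideanSpace ℝ (Fin d)) :
    ‖fourierHat f w‖ ≤ (2 * Real.pi) ^ (-(d : ℝ) / 2) * ∫ x, |f x| := by
  rw [fourierHat, norm_mul, Complex.norm_real, Real.norm_of_nonneg (by positivity)]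
  refine mul_le_mul_of_nonneg_left ((norm_integral_le_integral_norm _).trans (le_of_eq ?_))
    (by positivity)
  refine integral_congr_ae (.of_forall fun x => ?_)
  simp [Complex.norm_exp]

theorem fourierHat_sub {f g : EuclideanSpace ℝ (Fin d) → ℝ} (hf : Integrable f)
    (hg : Integrable g) (w : EuclideanSpace ℝ (Fin d)) :
    fourierHat (f - g) w = fourierHat f w - fourierHat g w := by
  have h : ∀ u : EuclideanSpace ℝ (Fin d) → ℝ, Integrable u →
      Integrable fun x => (u x : ℂ) * Complex.exp (-Complex.I * (⟪w, x⟫ : ℝ)) := fun u hu =>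
    hu.ofReal.mul_bdd (c := 1) (by fun_prop) (.of_forall fun x => by simp [Complex.norm_exp])
  simp only [fourierHat]
  rw [← mul_sub, ← integral_sub (h f hf) (h g hg)]
  simp only [Pi.sub_apply, Complex.ofReal_sub, sub_mul]

theorem fourierHat_im_eq_zero {f : EuclideanSpace ℝ (Fin d) → ℝ} (hf : ∀ x, f (-x) = f x)
    (w : EuclideanSpace ℝ (Fin d)) : (fourierHat f w).im = 0 := by
  rw [← Complex.conj_eq_iff_im, fourierHat, map_mul, Complex.conj_ofReal, ← integral_conj,
    ← integral_neg_eq_self]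
  congr 1
  refine integral_congr_ae (.of_forall fun x => ?_)
  simp [hf, ← Complex.exp_conj]

theorem eq_zero_of_fourierHat_eq_zero {f : EuclideanSpace ℝ (Fin d) → ℝ} (hc : Continuous f)
    (hf : Integrable f) (h : ∀ w, fourierHat f w = 0) : f = 0 := by
  have h0 : 𝓕 (fun x => (f x : ℂ)) = 0 := by
    ext w
    have h1 := h ((2 * Real.pi) • w)
    rw [fourierHat_eq_fourier, smul_smul, inv_mul_cancel₀ (by positivity), one_smul,
      mul_eq_zero] at h1
    refine h1.resolve_left ?_
    rw [Complex.ofReal_eq_zero]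
    positivity
  have h2 := Continuous.fourierInv_fourier_eq (f := fun x => (f x : ℂ)) (by fun_prop) hf.ofReal
    (by rw [h0]; exact integrable_zero _ _ _)
  ext x
  have h3 := congrFun h2 x
  simp only [h0, Real.fourierInv_eq, Pi.zero_apply, smul_zero, integral_zero] at h3
  exact_mod_cast h3.symm

/-- The normalisation is unitary: its square `(2π)^(-d)` cancels the Jacobian `(2π)^d` of the
frequency rescaling. -/
theorem integral_norm_sq_fourierHat_eq {f : EuclideanSpace ℝ (Fin d) → ℝ} (hc : Continuous f)
    (hf : Integrable f) (hf' : Integrable (fourierHat f)) :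
    ∫ w, ‖fourierHat f w‖ ^ 2 = ∫ x, f x ^ 2 := by
  have hpi : (0 : ℝ) < 2 * Real.pi := by positivity
  have hne : ((((2 * Real.pi) ^ (-(d : ℝ) / 2) : ℝ) : ℂ)) ≠ 0 := by
    rw [Ne, Complex.ofReal_eq_zero]
    positivity
  have hF : Integrable (𝓕 (fun x => (f x : ℂ))) := by
    have h1 := (hf'.const_mul ((((2 * Real.pi) ^ (-(d : ℝ) / 2) : ℝ) : ℂ))⁻¹).comp_smul hpi.ne'
    refine h1.congr (.of_forall fun w => ?_)
    simp only [fourierHat_eq_fourier, smul_smul, inv_mul_cancel₀ hpi.ne', one_smul]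
    rw [inv_mul_cancel_left₀ hne]
  have h := integral_norm_sq_fourier_eq (f := fun x => (f x : ℂ)) (by fun_prop) hf.ofReal hF
  simp only [Complex.norm_real, Real.norm_eq_abs, sq_abs] at h
  rw [← h]
  simp only [fourierHat_eq_fourier, norm_mul, mul_pow, Complex.norm_real]
  rw [integral_const_mul, Measure.integral_comp_smul volume
    (fun w => ‖𝓕 (fun x => (f x : ℂ)) w‖ ^ 2), finrank_euclideanSpace_fin, smul_eq_mul,
    ← mul_assoc, Real.norm_of_nonneg (by positivity), inv_pow, inv_inv, abs_of_pos (by positivity),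
    ← Real.rpow_natCast _ 2, ← Real.rpow_mul hpi.le, ← Real.rpow_natCast _ d, ← Real.rpow_add hpi]
  have h0 : -(d : ℝ) / 2 * ((2 : ℕ) : ℝ) + d = 0 := by push_cast; ring
  rw [h0, Real.rpow_zero, one_mul]

end Fourier

/-! ### Kernel mean embeddings as convolutions with `ψ`. -/

section KernelMean

theorem kerFun_one_apply {V : Type*} [AddGroup V] (ψ : V → ℝ) [Fact (IsPosDefFun ψ)] (x y : V) :
    RKHS.kerFun (KernelSpace ψ) x 1 y = ψ (y - x) := by
  rw [RKHS.kerFun_apply, RKHS.OfKernel.kernel_ofKernel]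
  simp [transKernel]

theorem kernelSpace_apply_eq_inner {V : Type*} [AddGroup V] (ψ : V → ℝ) [Fact (IsPosDefFun ψ)]
    (f : KernelSpace ψ) (y : V) : f y = ⟪RKHS.kerFun (KernelSpace ψ) y 1, f⟫ := by
  rw [RKHS.kerFun_inner]
  simp

theorem norm_sq_kerFun_one {V : Type*} [AddGroup V] (ψ : V → ℝ) [Fact (IsPosDefFun ψ)] (x : V) :
    ‖RKHS.kerFun (KernelSpace ψ) x 1‖ ^ 2 = ψ 0 := by
  rw [← real_inner_self_eq_norm_sq, ← kernelSpace_apply_eq_inner, kerFun_one_apply, sub_self]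

theorem continuous_kerFun_one {V : Type*} [AddGroup V] [TopologicalSpace V]
    [IsTopologicalAddGroup V] (ψ : V → ℝ) [Fact (IsPosDefFun ψ)] (hψ : Continuous ψ) :
    Continuous fun x => RKHS.kerFun (KernelSpace ψ) x 1 := by
  have h : ∀ x y : V, ‖RKHS.kerFun (KernelSpace ψ) x 1 - RKHS.kerFun (KernelSpace ψ) y 1‖ =
      √(2 * ψ 0 - 2 * ψ (x - y)) := fun x y => by
    have h1 := norm_sub_sq_real (RKHS.kerFun (KernelSpace ψ) x 1) (RKHS.kerFun (KernelSpace ψ) y 1)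
    rw [norm_sq_kerFun_one, norm_sq_kerFun_one, ← kernelSpace_apply_eq_inner,
      kerFun_one_apply] at h1
    rw [show 2 * ψ 0 - 2 * ψ (x - y) = ψ 0 - 2 * ψ (x - y) + ψ 0 by ring, ← h1,
      Real.sqrt_sq (norm_nonneg _)]
  rw [continuous_iff_continuousAt]
  intro y
  rw [ContinuousAt, tendsto_iff_norm_sub_tendsto_zero]
  simp_rw [h]
  have h1 : Continuous fun x => √(2 * ψ 0 - 2 * ψ (x - y)) := by fun_prop
  simpa using h1.tendsto y

theorem continuous_kernelSpace {V : Type*} [AddGroup V] [TopologicalSpace V]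
    [IsTopologicalAddGroup V] (ψ : V → ℝ) [Fact (IsPosDefFun ψ)] (hψ : Continuous ψ)
    (f : KernelSpace ψ) : Continuous f := by
  have h : (f : V → ℝ) = fun y => ⟪RKHS.kerFun (KernelSpace ψ) y 1, f⟫ :=
    funext (kernelSpace_apply_eq_inner ψ f)
  rw [h]
  exact (continuous_kerFun_one ψ hψ).inner continuous_const

theorem abs_kernelSpace_apply_le {V : Type*} [AddGroup V] (ψ : V → ℝ) [Fact (IsPosDefFun ψ)]
    (f : KernelSpace ψ) (y : V) : |f y| ≤ √(ψ 0) * ‖f‖ := by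
  rw [kernelSpace_apply_eq_inner, ← norm_sq_kerFun_one ψ y, Real.sqrt_sq (norm_nonneg _)]
  exact abs_real_inner_le_norm _ _

theorem kernelMean_apply {V : Type*} [AddGroup V] [TopologicalSpace V] [IsTopologicalAddGroup V]
    [SecondCountableTopology V] [MeasurableSpace V] [OpensMeasurableSpace V] (ψ : V → ℝ)
    [Fact (IsPosDefFun ψ)] (hψ : Continuous ψ) (P : Measure V) [IsFiniteMeasure P] (y : V) :
    kernelMean ψ P y = ∫ x, ψ (y - x) ∂P := by
  have hi : Integrable (fun x => RKHS.kerFun (KernelSpace ψ) x 1) P := by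
    refine Integrable.of_bound (continuous_kerFun_one ψ hψ).aestronglyMeasurable (√(ψ 0))
      (.of_forall fun x => ?_)
    rw [← norm_sq_kerFun_one ψ x, Real.sqrt_sq (norm_nonneg _)]
  rw [kernelSpace_apply_eq_inner, kernelMean, ← integral_inner hi]
  refine integral_congr_ae (.of_forall fun x => ?_)
  simp only [← kernelSpace_apply_eq_inner, kerFun_one_apply]

/-- Tonelli and translation invariance; this justifies Fubini for the convolution of `f` with `P`.
-/
theorem integrable_prod_comp_sub {V E : Type*} [AddGroup V] [MeasurableSpace V] [MeasurableAdd₂ V]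
    [MeasurableNeg V] [NormedAddCommGroup E] {μ P : Measure V} [SFinite μ]
    [μ.IsAddRightInvariant] [IsFiniteMeasure P] {f : V → E} (hm : StronglyMeasurable f)
    (hf : Integrable f μ) :
    Integrable (fun p : V × V => f (p.1 - p.2)) (μ.prod P) := by
  have : MeasurableSub₂ V := ⟨by simp_rw [sub_eq_add_neg]; fun_prop⟩
  have hm' : StronglyMeasurable fun p : V × V => f (p.1 - p.2) := hm.comp_measurable measurable_sub
  rw [integrable_prod_iff' hm'.aestronglyMeasurable]
  refine ⟨.of_forall fun x => hf.comp_sub_right x, ?_⟩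
  have h : ∀ x, ∫ y, ‖f (y - x)‖ ∂μ = ∫ y, ‖f y‖ ∂μ := fun x =>
    integral_sub_right_eq_self (fun y => ‖f y‖) x
  simp_rw [h]
  exact integrable_const _

variable {d : ℕ} {ψ : EuclideanSpace ℝ (Fin d) → ℝ} [Fact (IsPosDefFun ψ)]

theorem integrable_kernelMean (hψ : Continuous ψ) (hint : Integrable ψ)
    (P : Measure (EuclideanSpace ℝ (Fin d))) [IsFiniteMeasure P] :
    Integrable (kernelMean ψ P) := by
  have h := (integrable_prod_comp_sub (P := P) hψ.stronglyMeasurable hint).integral_prod_left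
  exact h.congr (.of_forall fun y => (kernelMean_apply ψ hψ P y).symm)

/-- An integrable function that is also bounded is square integrable; the bound comes from the
reproducing property. -/
theorem memLp_two_kernelMean (hψ : Continuous ψ) (hint : Integrable ψ)
    (P : Measure (EuclideanSpace ℝ (Fin d))) [IsFiniteMeasure P] :
    MemLp (kernelMean ψ P) 2 := by
  have hm := (continuous_kernelSpace ψ hψ (kernelMean ψ P)).aestronglyMeasurable (μ := volume)
  rw [memLp_two_iff_integrable_sq hm]
  refine ((integrable_kernelMean hψ hint P).norm.const_mul (√(ψ 0) * ‖kernelMean ψ P‖)).mono'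
    (hm.pow 2) (.of_forall fun y => ?_)
  rw [Real.norm_of_nonneg (sq_nonneg _), ← sq_abs, sq, Real.norm_eq_abs]
  gcongr
  exact abs_kernelSpace_apply_le ψ _ y

/-- The convolution theorem. The argument `-w` appears because `charFun` uses the exponent `+i`. -/
theorem fourierHat_kernelMean (hψ : Continuous ψ) (hint : Integrable ψ)
    (P : Measure (EuclideanSpace ℝ (Fin d))) [IsFiniteMeasure P] (w : EuclideanSpace ℝ (Fin d)) :
    fourierHat (kernelMean ψ P) w = fourierHat ψ w * charFun P (-w) := by
  have hi := integrable_prod_comp_sub (P := P) (f := fun x => (ψ x : ℂ))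
    (by fun_prop) hint.ofReal
  have hi2 : Integrable (fun p : EuclideanSpace ℝ (Fin d) × EuclideanSpace ℝ (Fin d) =>
      (ψ (p.1 - p.2) : ℂ) * Complex.exp (-Complex.I * (⟪w, p.1⟫ : ℝ))) (volume.prod P) := by
    refine hi.mul_bdd (c := 1) (by fun_prop) (.of_forall fun p => ?_)
    simp [Complex.norm_exp]
  have h1 : ∀ y, (kernelMean ψ P y : ℂ) * Complex.exp (-Complex.I * (⟪w, y⟫ : ℝ)) =
      ∫ x, (ψ (y - x) : ℂ) * Complex.exp (-Complex.I * (⟪w, y⟫ : ℝ)) ∂P := fun y => by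
    rw [kernelMean_apply ψ hψ, ← integral_complex_ofReal, integral_mul_const]
  have h2 : ∀ x, ∫ y, (ψ (y - x) : ℂ) * Complex.exp (-Complex.I * (⟪w, y⟫ : ℝ)) =
      (∫ y, (ψ y : ℂ) * Complex.exp (-Complex.I * (⟪w, y⟫ : ℝ))) *
        Complex.exp ((⟪x, -w⟫ : ℝ) * Complex.I) := fun x => by
    rw [← integral_add_right_eq_self _ x, ← integral_mul_const]
    refine integral_congr_ae (.of_forall fun y => ?_)
    simp only [add_sub_cancel_right, mul_assoc, ← Complex.exp_add, inner_add_right,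
      inner_neg_right, real_inner_comm]
    congr 2
    push_cast
    ring
  rw [fourierHat, fourierHat, mul_assoc]
  congr 1
  simp_rw [h1]
  rw [integral_integral_swap hi2]
  simp_rw [h2]
  rw [integral_const_mul, charFun_apply]

/-- A zero kernel would embed two distinct Dirac measures identically. -/
theorem exists_ne_zero_of_isCharacteristicFun {V : Type*} [AddGroup V] [MeasurableSpace V]
    [MeasurableSingletonClass V] [Nontrivial V] {ψ : V → ℝ} [Fact (IsPosDefFun ψ)]
    (h : IsCharacteristicFun ψ) : ψ ≠ 0 := by
  intro h0
  have hk : ∀ x : V, RKHS.kerFun (KernelSpace ψ) x 1 = 0 := fun x => by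
    have h1 := norm_sq_kerFun_one ψ x
    simpa [show ψ 0 = 0 from congrFun h0 0] using h1
  obtain ⟨x, y, hxy⟩ := exists_pair_ne V
  have h1 := @h ⟨Measure.dirac x, inferInstance⟩ ⟨Measure.dirac y, inferInstance⟩
    (by simp only [kernelMean, hk, integral_zero])
  exact hxy (dirac_eq_dirac_iff.mp (congrArg Subtype.val h1))

end KernelMean

/-! ### Cosine bounds and the weighted integrals. -/

section WeightedIntegral

/-- Write the right side as `4 sin²(t/2)` and square `sin x ≥ x - x³/6`, dropping the sixth-order
term. -/
theorem one_sub_cos_ge (t : ℝ) : t ^ 2 - t ^ 4 / 12 ≤ 2 * (1 - Real.cos t) := by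
  wlog ht : 0 ≤ t generalizing t
  · simpa [even_two.neg_pow, Even.neg_pow (show Even 4 by decide)] using this (-t) (by linarith)
  have h := Real.sin_ge_sub_cube (x := t / 2) (by linarith)
  have h2 : 2 * (1 - Real.cos t) = 4 * Real.sin (t / 2) ^ 2 := by
    rw [Real.sin_sq_eq_half_sub]
    ring_nf
  rw [h2]
  -- Squaring needs the cubic to be nonnegative. Otherwise `t = 0` or `t² ≥ 24`, and the left side
  -- is already nonpositive.
  rcases le_total (t / 2 - (t / 2) ^ 3 / 6) 0 with h3 | h3
  · have h4 : 0 ≤ t * (t ^ 2 - 24) := by nlinarith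
    rcases ht.eq_or_lt with rfl | ht
    · simp
    · have h5 : 24 ≤ t ^ 2 := by nlinarith
      nlinarith [sq_nonneg (Real.sin (t / 2)), sq_nonneg t]
  · have h4 := pow_le_pow_left₀ h3 h 2
    nlinarith [sq_nonneg (t ^ 3)]

variable {d : ℕ}

theorem weightedIntegrand_zero_left (ψ : EuclideanSpace ℝ (Fin d) → ℝ) (σ : ℝ)
    (e w : EuclideanSpace ℝ (Fin d)) : weightedIntegrand ψ σ 0 e w =
      Real.exp (-σ ^ 2 * ‖w‖ ^ 2) * ⟪e, w⟫ ^ 2 * (fourierHat ψ w).re ^ 2 := by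
  simp [weightedIntegrand]

variable {ψ : EuclideanSpace ℝ (Fin d) → ℝ} {σ : ℝ}

theorem continuous_uncurry_weightedIntegrand (hint : Integrable ψ)
    (a : EuclideanSpace ℝ (Fin d)) :
    Continuous fun p : EuclideanSpace ℝ (Fin d) × EuclideanSpace ℝ (Fin d) =>
      weightedIntegrand ψ σ a p.1 p.2 := by
  have := continuous_fourierHat hint
  unfold weightedIntegrand
  generalize fourierHat ψ = F at *
  fun_prop

theorem continuous_weightedIntegrand (hint : Integrable ψ) (a e : EuclideanSpace ℝ (Fin d)) :
    Continuous (weightedIntegrand ψ σ a e) := by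
  have := continuous_fourierHat hint
  unfold weightedIntegrand
  generalize fourierHat ψ = F at *
  fun_prop

theorem sq_fourierHat_re_le (w : EuclideanSpace ℝ (Fin d)) :
    (fourierHat ψ w).re ^ 2 ≤ ((2 * Real.pi) ^ (-(d : ℝ) / 2) * ∫ x, |ψ x|) ^ 2 := by
  rw [← sq_abs]
  gcongr
  exact (Complex.abs_re_le_norm _).trans (norm_fourierHat_le ψ w)

theorem integrable_gaussian_mul_sq_fourierHat (hσ : 0 < σ) (hint : Integrable ψ) (k : ℕ) :
    Integrable fun w => Real.exp (-σ ^ 2 * ‖w‖ ^ 2) * ‖w‖ ^ (2 * k) * (fourierHat ψ w).re ^ 2 := by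
  have := continuous_fourierHat hint
  refine (integrable_exp_neg_mul_sq_norm_mul_pow (pow_pos hσ 2) k).mul_bdd
    (c := ((2 * Real.pi) ^ (-(d : ℝ) / 2) * ∫ x, |ψ x|) ^ 2)
    ((Complex.continuous_re.comp this).pow 2).aestronglyMeasurable
    (.of_forall fun w => ?_)
  rw [Real.norm_of_nonneg (sq_nonneg _)]
  exact sq_fourierHat_re_le w

theorem sq_inner_le_sq_norm_mul (e w : EuclideanSpace ℝ (Fin d)) :
    ⟪e, w⟫ ^ 2 ≤ ‖e‖ ^ 2 * ‖w‖ ^ 2 := by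
  rw [← mul_pow, ← sq_abs]
  gcongr
  exact abs_real_inner_le_norm e w

theorem norm_weightedIntegrand_le (a e w : EuclideanSpace ℝ (Fin d)) :
    ‖weightedIntegrand ψ σ a e w‖ ≤
      ‖e‖ ^ 2 * (Real.exp (-σ ^ 2 * ‖w‖ ^ 2) * ‖w‖ ^ (2 * 1) * (fourierHat ψ w).re ^ 2) := by
  have h1 := sq_inner_le_sq_norm_mul e w
  have h2 := Real.abs_cos_le_one ⟪a, w⟫
  rw [weightedIntegrand, norm_mul, norm_mul, Real.norm_of_nonneg (by positivity),
    Real.norm_of_nonneg (sq_nonneg _), Real.norm_eq_abs]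
  calc Real.exp (-σ ^ 2 * ‖w‖ ^ 2) * ⟪e, w⟫ ^ 2 * |Real.cos ⟪a, w⟫| * (fourierHat ψ w).re ^ 2
      ≤ Real.exp (-σ ^ 2 * ‖w‖ ^ 2) * (‖e‖ ^ 2 * ‖w‖ ^ 2) * 1 * (fourierHat ψ w).re ^ 2 := by
        gcongr
    _ = _ := by ring

theorem integrable_weightedIntegrand (hσ : 0 < σ) (hint : Integrable ψ)
    (a e : EuclideanSpace ℝ (Fin d)) : Integrable (weightedIntegrand ψ σ a e) :=
  ((integrable_gaussian_mul_sq_fourierHat hσ hint 1).const_mul (‖e‖ ^ 2)).mono'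
    (continuous_weightedIntegrand hint a e).aestronglyMeasurable
    (.of_forall (norm_weightedIntegrand_le a e))

theorem continuousOn_integral_weightedIntegrand (hσ : 0 < σ) (hint : Integrable ψ)
    (a : EuclideanSpace ℝ (Fin d)) :
    ContinuousOn (fun e => 2 * ∫ w, weightedIntegrand ψ σ a e w)
      (Metric.sphere (0 : EuclideanSpace ℝ (Fin d)) 1) := by
  refine continuousOn_const.mul (continuousOn_of_dominated
    (bound := fun w => Real.exp (-σ ^ 2 * ‖w‖ ^ 2) * ‖w‖ ^ (2 * 1) * (fourierHat ψ w).re ^ 2)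
    (fun e _ => (continuous_weightedIntegrand hint a e).aestronglyMeasurable) (fun e he => ?_)
    (integrable_gaussian_mul_sq_fourierHat hσ hint 1) ?_)
  · refine .of_forall fun w => (norm_weightedIntegrand_le a e w).trans (le_of_eq ?_)
    rw [mem_sphere_zero_iff_norm.mp he, one_pow, one_mul]
  · exact .of_forall fun w => ((continuous_uncurry_weightedIntegrand hint a).comp
      (Continuous.prodMk_left w)).continuousOn

theorem exists_isLeast_integral_weightedIntegrand (hd : 0 < d) (hσ : 0 < σ) (hint : Integrable ψ)
    (a : EuclideanSpace ℝ (Fin d)) :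
    ∃ m, IsLeast ((fun e => 2 * ∫ w, weightedIntegrand ψ σ a e w) ''
      Metric.sphere (0 : EuclideanSpace ℝ (Fin d)) 1) m := by
  have : Nonempty (Fin d) := ⟨⟨0, hd⟩⟩
  exact ((isCompact_sphere _ _).image_of_continuousOn
    (continuousOn_integral_weightedIntegrand hσ hint a)).exists_isLeast
    ((NormedSpace.sphere_nonempty.mpr zero_le_one).image _)

theorem integral_weightedIntegrand_zero_pos (hσ : 0 < σ) (hc : Continuous ψ)
    (hint : Integrable ψ) (hsymm : ∀ x, ψ (-x) = ψ x) (hne : ψ ≠ 0)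
    {e : EuclideanSpace ℝ (Fin d)} (he : e ≠ 0) : 0 < ∫ w, weightedIntegrand ψ σ 0 e w := by
  have hcont := continuous_fourierHat hint
  obtain ⟨w₀, hw₀⟩ : ∃ w, fourierHat ψ w ≠ 0 := by
    by_contra! h
    exact hne (eq_zero_of_fourierHat_eq_zero hc hint h)
  obtain ⟨w, hw, hew⟩ : ∃ w, fourierHat ψ w ≠ 0 ∧ ⟪e, w⟫ ≠ 0 := by
    -- If `w₀ ⊥ e`, a small move along `e` leaves the hyperplane while continuity keeps `ψ^`
    -- nonzero.
    by_cases h : ⟪e, w₀⟫ = 0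
    · have h1 : ∀ᶠ t : ℝ in nhds 0, fourierHat ψ (w₀ + t • e) ≠ 0 := by
        refine ContinuousAt.eventually_ne (by fun_prop) ?_
        simpa using hw₀
      obtain ⟨t, ht, ht0⟩ := ((h1.filter_mono nhdsWithin_le_nhds).and
        (self_mem_nhdsWithin (a := (0 : ℝ)) (s := {0}ᶜ))).exists
      refine ⟨_, ht, ?_⟩
      rw [inner_add_right, h, zero_add, inner_smul_right]
      exact mul_ne_zero ht0 (inner_self_ne_zero.mpr he)
    · exact ⟨w₀, hw₀, h⟩
  have hre : (fourierHat ψ w).re ≠ 0 := fun h =>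
    hw (Complex.ext h (fourierHat_im_eq_zero hsymm w))
  refine integral_pos_of_integrable_nonneg_nonzero (x := w) (continuous_weightedIntegrand hint 0 e)
    (integrable_weightedIntegrand hσ hint 0 e) (fun v => ?_) ?_
  · rw [weightedIntegrand_zero_left]
    positivity
  · rw [weightedIntegrand_zero_left]
    positivity

/-- Integrates `cos t ≥ 1 - t²/2`, with Cauchy–Schwarz applied to both inner products in the error
term. -/
theorem integral_weightedIntegrand_ge (hσ : 0 < σ) (hint : Integrable ψ)
    (a e : EuclideanSpace ℝ (Fin d)) :
    2 * (∫ w, weightedIntegrand ψ σ 0 e w) - ‖e‖ ^ 2 * ‖a‖ ^ 2 *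
      (∫ w, Real.exp (-σ ^ 2 * ‖w‖ ^ 2) * ‖w‖ ^ (2 * 2) * (fourierHat ψ w).re ^ 2) ≤
      2 * ∫ w, weightedIntegrand ψ σ a e w := by
  rw [← integral_const_mul, ← integral_const_mul, ← integral_const_mul, ← integral_sub]
  · refine integral_mono ?_ ((integrable_weightedIntegrand hσ hint a e).const_mul 2) fun w => ?_
    · exact ((integrable_weightedIntegrand hσ hint 0 e).const_mul 2).sub
        ((integrable_gaussian_mul_sq_fourierHat hσ hint 2).const_mul _)
    · simp only [weightedIntegrand_zero_left]
      have h1 := Real.one_sub_sq_div_two_le_cos (x := ⟪a, w⟫)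
      have h2 : ⟪e, w⟫ ^ 2 * ⟪a, w⟫ ^ 2 ≤ (‖e‖ ^ 2 * ‖w‖ ^ 2) * (‖a‖ ^ 2 * ‖w‖ ^ 2) :=
        mul_le_mul (sq_inner_le_sq_norm_mul e w) (sq_inner_le_sq_norm_mul a w) (sq_nonneg _)
          (by positivity)
      have h3 : 2 * ⟪e, w⟫ ^ 2 - ‖e‖ ^ 2 * ‖a‖ ^ 2 * ‖w‖ ^ (2 * 2) ≤
          2 * (⟪e, w⟫ ^ 2 * Real.cos ⟪a, w⟫) := by
        have h0 := mul_le_mul_of_nonneg_left h1 (sq_nonneg ⟪e, w⟫)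
        linear_combination 2 * h0 + h2
      have h4 : 0 ≤ Real.exp (-σ ^ 2 * ‖w‖ ^ 2) * (fourierHat ψ w).re ^ 2 := by positivity
      have h5 := mul_le_mul_of_nonneg_left h3 h4
      simp only [weightedIntegrand]
      linarith
  · exact (integrable_weightedIntegrand hσ hint 0 e).const_mul 2
  · exact (integrable_gaussian_mul_sq_fourierHat hσ hint 2).const_mul _

theorem integral_one_sub_cos_ge (hσ : 0 < σ) (hint : Integrable ψ)
    (a : EuclideanSpace ℝ (Fin d)) :
    (∫ w, weightedIntegrand ψ σ 0 a w) - ‖a‖ ^ 4 / 12 *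
      (∫ w, Real.exp (-σ ^ 2 * ‖w‖ ^ 2) * ‖w‖ ^ (2 * 2) * (fourierHat ψ w).re ^ 2) ≤
      ∫ w, Real.exp (-σ ^ 2 * ‖w‖ ^ 2) * (fourierHat ψ w).re ^ 2 *
        (2 * (1 - Real.cos ⟪a, w⟫)) := by
  have hcont := continuous_fourierHat hint
  have hi : Integrable fun w => Real.exp (-σ ^ 2 * ‖w‖ ^ 2) * (fourierHat ψ w).re ^ 2 := by
    simpa using integrable_gaussian_mul_sq_fourierHat hσ hint 0
  rw [← integral_const_mul, ← integral_sub]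
  · refine integral_mono ?_ ?_ fun w => ?_
    · exact (integrable_weightedIntegrand hσ hint 0 a).sub
        ((integrable_gaussian_mul_sq_fourierHat hσ hint 2).const_mul _)
    · refine hi.mul_bdd (c := 4) (by fun_prop) (.of_forall fun w => ?_)
      rw [Real.norm_eq_abs, abs_le]
      constructor <;> linarith [Real.neg_one_le_cos ⟪a, w⟫, Real.cos_le_one ⟪a, w⟫]
    · simp only [weightedIntegrand_zero_left]
      have h1 := one_sub_cos_ge ⟪a, w⟫
      have h2 := pow_le_pow_left₀ (sq_nonneg _) (sq_inner_le_sq_norm_mul a w) 2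
      have h3 : ⟪a, w⟫ ^ 2 - ‖a‖ ^ 4 / 12 * ‖w‖ ^ (2 * 2) ≤ 2 * (1 - Real.cos ⟪a, w⟫) := by
        nlinarith
      have h4 : 0 ≤ Real.exp (-σ ^ 2 * ‖w‖ ^ 2) * (fourierHat ψ w).re ^ 2 := by positivity
      have h5 := mul_le_mul_of_nonneg_left h3 h4
      linarith
  · exact integrable_weightedIntegrand hσ hint 0 a
  · exact (integrable_gaussian_mul_sq_fourierHat hσ hint 2).const_mul _

theorem integral_weightedIntegrand_zero_smul (t : ℝ) (e : EuclideanSpace ℝ (Fin d)) :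
    ∫ w, weightedIntegrand ψ σ 0 (t • e) w = t ^ 2 * ∫ w, weightedIntegrand ψ σ 0 e w := by
  rw [← integral_const_mul]
  refine integral_congr_ae (.of_forall fun w => ?_)
  simp only [weightedIntegrand_zero_left, real_inner_smul_left]
  ring

end WeightedIntegral

/-! ### The `L²` distance between embedded Gaussians. -/

section Gaussian

variable {d : ℕ} {ψ : EuclideanSpace ℝ (Fin d) → ℝ} [Fact (IsPosDefFun ψ)]

theorem charFun_multivariateGaussian_smul_one (μ t : EuclideanSpace ℝ (Fin d)) (σ : ℝ) :
    charFun (multivariateGaussian μ (σ ^ 2 • 1)) t =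
      Complex.exp ((⟪t, μ⟫ : ℝ) * Complex.I - ((σ ^ 2 * ‖t‖ ^ 2 / 2 : ℝ) : ℂ)) := by
  rw [charFun_multivariateGaussian (Matrix.PosSemidef.one.smul (sq_nonneg σ))]
  congr 2
  rw [Matrix.smul_mulVec, Matrix.one_mulVec, dotProduct_smul, EuclideanSpace.real_norm_sq_eq]
  simp [dotProduct, sq]

theorem norm_sq_charFun_multivariateGaussian_sub (μ₀ μ₁ t : EuclideanSpace ℝ (Fin d)) (σ : ℝ) :
    ‖charFun (multivariateGaussian μ₀ (σ ^ 2 • 1)) t -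
      charFun (multivariateGaussian μ₁ (σ ^ 2 • 1)) t‖ ^ 2 =
      Real.exp (-σ ^ 2 * ‖t‖ ^ 2) * (2 * (1 - Real.cos ⟪μ₀ - μ₁, t⟫)) := by
  have h : ∀ x y r : ℝ, ‖Complex.exp (x * Complex.I - (r : ℂ)) -
      Complex.exp (y * Complex.I - (r : ℂ))‖ ^ 2 =
      Real.exp (-(2 * r)) * (2 * (1 - Real.cos (x - y))) := fun x y r => by
    rw [Complex.sq_norm, Complex.normSq_apply, Real.cos_sub, two_mul r, neg_add, Real.exp_add]
    simp only [Complex.sub_re, Complex.sub_im, Complex.exp_re, Complex.exp_im, Complex.mul_re,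
      Complex.mul_im, Complex.ofReal_re, Complex.ofReal_im, Complex.I_re, Complex.I_im, mul_zero,
      mul_one, sub_zero, zero_sub, add_zero]
    linear_combination Real.exp (-r) ^ 2 * (Real.sin_sq_add_cos_sq x + Real.sin_sq_add_cos_sq y)
  rw [charFun_multivariateGaussian_smul_one, charFun_multivariateGaussian_smul_one, h,
    inner_sub_left, real_inner_comm μ₀, real_inner_comm μ₁]
  congr 2
  ring

/-- Bounded `ψ^` times Gaussian decay; Plancherel as proved above requires an integrable transform.
-/
theorem integrable_fourierHat_kernelMean_gaussian {σ : ℝ} (hσ : 0 < σ) (hψ : Continuous ψ)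
    (hint : Integrable ψ) (μ : EuclideanSpace ℝ (Fin d)) :
    Integrable (fourierHat (kernelMean ψ (multivariateGaussian μ (σ ^ 2 • 1)))) := by
  have h := integrable_exp_neg_mul_sq_norm_mul_pow (d := d) (b := σ ^ 2 / 2) (by positivity) 0
  refine (h.const_mul ((2 * Real.pi) ^ (-(d : ℝ) / 2) * ∫ x, |ψ x|)).mono'
    (continuous_fourierHat (integrable_kernelMean hψ hint _)).aestronglyMeasurable
    (.of_forall fun w => ?_)
  rw [fourierHat_kernelMean hψ hint, norm_mul, charFun_multivariateGaussian_smul_one,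
    Complex.norm_exp]
  refine mul_le_mul (norm_fourierHat_le ψ w) (le_of_eq ?_) (by positivity)
    ((norm_nonneg _).trans (norm_fourierHat_le ψ w))
  simp only [Complex.sub_re, Complex.mul_re, Complex.ofReal_re, Complex.ofReal_im, Complex.I_re,
    Complex.I_im, mul_zero, sub_zero, zero_sub, norm_neg, mul_one, pow_zero]
  ring_nf

theorem integral_sq_kernelMean_gaussian_sub {σ : ℝ} (hσ : 0 < σ) (hψ : Continuous ψ)
    (hint : Integrable ψ) (μ₀ μ₁ : EuclideanSpace ℝ (Fin d)) :
    ∫ y, (kernelMean ψ (multivariateGaussian μ₀ (σ ^ 2 • 1)) -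
        kernelMean ψ (multivariateGaussian μ₁ (σ ^ 2 • 1))) y ^ 2 =
      ∫ w, Real.exp (-σ ^ 2 * ‖w‖ ^ 2) * (fourierHat ψ w).re ^ 2 *
        (2 * (1 - Real.cos ⟪μ₀ - μ₁, w⟫)) := by
  set P := multivariateGaussian μ₀ (σ ^ 2 • 1)
  set Q := multivariateGaussian μ₁ (σ ^ 2 • 1)
  have hsymm := (Fact.out : IsPosDefFun ψ).1
  have hint' : Integrable (kernelMean ψ P - kernelMean ψ Q) := by
    rw [RKHS.coe_sub]
    exact (integrable_kernelMean hψ hint P).sub (integrable_kernelMean hψ hint Q)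
  have hF : ∀ w, fourierHat (kernelMean ψ P - kernelMean ψ Q) w =
      fourierHat ψ w * (charFun P (-w) - charFun Q (-w)) := fun w => by
    rw [mul_sub, ← fourierHat_kernelMean hψ hint, ← fourierHat_kernelMean hψ hint, RKHS.coe_sub,
      fourierHat_sub (integrable_kernelMean hψ hint P) (integrable_kernelMean hψ hint Q)]
  have hF2 : ∀ w, ‖fourierHat (kernelMean ψ P - kernelMean ψ Q) w‖ ^ 2 =
      Real.exp (-σ ^ 2 * ‖w‖ ^ 2) * (fourierHat ψ w).re ^ 2 *
        (2 * (1 - Real.cos ⟪μ₀ - μ₁, w⟫)) := fun w => by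
    rw [hF, norm_mul, mul_pow, norm_sq_charFun_multivariateGaussian_sub, Complex.sq_norm,
      Complex.normSq_apply, fourierHat_im_eq_zero hsymm, norm_neg, inner_neg_right, Real.cos_neg]
    ring
  rw [← integral_norm_sq_fourierHat_eq (continuous_kernelSpace ψ hψ _) hint']
  · simp_rw [hF2]
  · rw [RKHS.coe_sub, funext (fourierHat_sub (integrable_kernelMean hψ hint P)
      (integrable_kernelMean hψ hint Q))]
    exact (integrable_fourierHat_kernelMean_gaussian hσ hψ hint μ₀).sub
      (integrable_fourierHat_kernelMean_gaussian hσ hψ hint μ₁)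

end Gaussian

/-! ### Choice of constants and the two lower bounds. -/

theorem proposition11 {d : ℕ} (hd : 0 < d) (σ : ℝ) (hσ : 0 < σ)
    (ψ : EuclideanSpace ℝ (Fin d) →ᵇ ℝ) [Fact (IsPosDefFun ψ)]
    (hint : Integrable ψ) (hchar : IsCharacteristicFun ψ) :
    (∀ w, (fourierHat ψ w).im = 0) ∧
    ∃ ε c : ℝ, 0 < ε ∧ 0 < c ∧
      (∀ a : EuclideanSpace ℝ (Fin d), ‖a‖ ^ 2 ≤ ε →
        (∀ e ∈ Metric.sphere (0 : EuclideanSpace ℝ (Fin d)) 1,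
          Integrable (weightedIntegrand ψ σ a e)) ∧
        ∃ m : ℝ, IsLeast ((fun e => 2 * ∫ w, weightedIntegrand ψ σ a e w) ''
          Metric.sphere (0 : EuclideanSpace ℝ (Fin d)) 1) m ∧ c ≤ m) ∧
      (∀ μ₀ μ₁ : EuclideanSpace ℝ (Fin d), ‖μ₀ - μ₁‖ ^ 2 ≤ ε →
        MemLp (kernelMean ψ (multivariateGaussian μ₀ (σ ^ 2 • 1))) 2 ∧
        MemLp (kernelMean ψ (multivariateGaussian μ₁ (σ ^ 2 • 1))) 2 ∧
        Real.sqrt (c / 2) * ‖μ₀ - μ₁‖ ≤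
          (eLpNorm (fun y => (kernelMean ψ (multivariateGaussian μ₀ (σ ^ 2 • 1)) -
            kernelMean ψ (multivariateGaussian μ₁ (σ ^ 2 • 1))) y) 2 volume).toReal) := by
  have hψ : Continuous ψ := ψ.continuous
  have hsymm := (Fact.out : IsPosDefFun ψ).1
  have : Nonempty (Fin d) := ⟨⟨0, hd⟩⟩
  have hne := exists_ne_zero_of_isCharacteristicFun hchar
  refine ⟨fourierHat_im_eq_zero hsymm, ?_⟩
  set K := ∫ w, Real.exp (-σ ^ 2 * ‖w‖ ^ 2) * ‖w‖ ^ (2 * 2) * (fourierHat ψ w).re ^ 2 with hK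
  have hK0 : 0 ≤ K := integral_nonneg fun w => by positivity
  obtain ⟨m₀, ⟨⟨e₀, he₀, hm₀⟩, hmin⟩⟩ :=
    exists_isLeast_integral_weightedIntegrand hd hσ hint (0 : EuclideanSpace ℝ (Fin d))
  have hm₀pos : 0 < m₀ := by
    rw [← hm₀]
    exact mul_pos two_pos (integral_weightedIntegrand_zero_pos hσ hψ hint hsymm hne
      (Metric.ne_of_mem_sphere he₀ one_ne_zero))
  -- The `+ 1` guarantees a positive denominator without knowing that `K > 0`.
  have hbound : ∀ a : EuclideanSpace ℝ (Fin d), ‖a‖ ^ 2 ≤ m₀ / (2 * (K + 1)) →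
      ‖a‖ ^ 2 * K ≤ m₀ / 2 := fun a ha => by
    rw [le_div_iff₀ (by positivity)] at ha
    nlinarith [sq_nonneg ‖a‖]
  -- With this `ε` the cosine error is at most `m₀/2`, so half of the minimum survives as `c`.
  refine ⟨m₀ / (2 * (K + 1)), m₀ / 2, by positivity, by positivity, fun a ha => ⟨fun e _ =>
    integrable_weightedIntegrand hσ hint a e, ?_⟩, fun μ₀ μ₁ hμ =>
    ⟨memLp_two_kernelMean hψ hint _, memLp_two_kernelMean hψ hint _, ?_⟩⟩
  · obtain ⟨m, ⟨e, he, hm⟩, hm'⟩ := exists_isLeast_integral_weightedIntegrand hd hσ hint a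
    refine ⟨m, ⟨⟨e, he, hm⟩, hm'⟩, ?_⟩
    have h1 := integral_weightedIntegrand_ge hσ hint a e
    have h2 := hmin ⟨e, he, rfl⟩
    rw [mem_sphere_zero_iff_norm.mp he, one_pow, one_mul, ← hK] at h1
    simp only at h2 hm
    linarith [hbound a ha]
  · set a := μ₀ - μ₁ with ha
    set f := kernelMean ψ (multivariateGaussian μ₀ (σ ^ 2 • 1)) -
      kernelMean ψ (multivariateGaussian μ₁ (σ ^ 2 • 1)) with hf
    have hfL : MemLp f 2 := by
      rw [hf, RKHS.coe_sub]
      exact (memLp_two_kernelMean hψ hint _).sub (memLp_two_kernelMean hψ hint _)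
    have hnorm : (eLpNorm (fun y => f y) 2 volume).toReal = √(∫ y, f y ^ 2) := by
      rw [hfL.eLpNorm_eq_integral_rpow_norm two_ne_zero ENNReal.ofNat_ne_top,
        ENNReal.toReal_ofReal (by positivity), Real.sqrt_eq_rpow]
      simp
    have h1 := integral_one_sub_cos_ge hσ hint a
    rw [← integral_sq_kernelMean_gaussian_sub hσ hψ hint, ← hf, ← hK] at h1
    -- Degree-two homogeneity reduces to the unit vector `a/‖a‖`; `a = 0` is trivial.
    have h2 : ‖a‖ ^ 2 * (m₀ / 2) ≤ ∫ w, weightedIntegrand ψ σ 0 a w := by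
      rcases eq_or_ne a 0 with h0 | h0
      · rw [h0]
        simp [weightedIntegrand]
      · have h3 : ‖a‖⁻¹ • a ∈ Metric.sphere (0 : EuclideanSpace ℝ (Fin d)) 1 := by
          rw [mem_sphere_zero_iff_norm]
          exact norm_smul_inv_norm (𝕜 := ℝ) h0
        have h4 := hmin ⟨_, h3, rfl⟩
        have h5 := integral_weightedIntegrand_zero_smul (ψ := ψ) (σ := σ) ‖a‖ (‖a‖⁻¹ • a)
        rw [smul_inv_smul₀ (norm_ne_zero_iff.mpr h0)] at h5
        rw [h5]
        gcongr
        simp only at h4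
        linarith
    rw [hnorm]
    refine Real.le_sqrt_of_sq_le ?_
    rw [mul_pow, Real.sq_sqrt (by positivity)]
    have h6 := mul_le_mul_of_nonneg_left (hbound a hμ) (sq_nonneg ‖a‖)
    -- The error is at most `‖a‖² m₀/24`, and `m₀/2 - m₀/24` exceeds `c/2 = m₀/4`.
    nlinarith [mul_nonneg (sq_nonneg ‖a‖) hm₀pos.le]
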